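/- Let $f,g\in\mathbb{C}[x]$, $m=\deg f$, $n=\deg g$, with $m<n<2m+1$, and let $f_0,g_0\neq 0$ be the leading coefficients of $f=f_0x^m+\dots+f_m$ and $g=g_0x^n+\dots+g_n$. Consider the Liénard system $$x_t=y,\qquad y_t=-f(x)y-g(x),$$ with vector field $\mathcal{X}=y\,\partial_x-(f(x)y+g(x))\,\partial_y$. An invariant algebraic curve of the system is a polynomial $F\in\mathbb{C}[x,y]\setminus\mathbb{C}$ such that $\mathcal{X}F=\lambda F$ for some $\lambda\in\mathbb{C}[x,y]$; polynomials that differ by a nonzero constant factor define the same curve. Let $q(x)=\sum_{l=0}^{m}q_l\,x^{m+1-l}$, where $q_0=-\frac{f_0}{m+1}$ and, for $1\le l\le m$, $$q_l=\frac{m+1}{(m+1-l)f_0}\Big\{\sum_{k=0}^{l-1}q_kf_{l-k}+\sum_{k=1}^{l-1}(m+1-k)q_kq_{l-k}+g_{n+l-(2m+1)}\Big\},$$ with $g_{j}=0$ for $j<0$. Then: 1. The system has at most two distinct irreducible invariant algebraic curves. 2. There is exactly one Laurent series $y_{II}(x)=-\frac{g_0}{f_0}x^{n-m}+\sum_{l\ge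 1}a_l x^{n-m-l}$ near $x=\infty$ (the series of type (II)) that satisfies $yy_x+f(x)y+g(x)=0$. If the system has two distinct irreducible invariant algebraic curves, then one of them, $G$, captures this series, that is $G(x,y_{II}(x))=0$, and does so with exponent $k=1$ (the root $y=y_{II}(x)$ of $G$ is simple); the other one is, up to a constant factor, $y-q(x)-z_0$ with $z_0\in\mathbb{C}$, and $z_0$ is the only complex number $z$ for which $y-q(x)-z$ is an invariant algebraic curve of the system. 3. The system has no rational first integral: there is no non-constant rational function $R\in\mathbb{C}(x,y)$ with $\mathcal{X}R=0$. -/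

import Mathlib

open Polynomial
open scoped Polynomial.Bivariate

namespace Lienard

noncomputable section

/-! Elements of `ℂ[X][Y]` are the polynomials in two variables over `ℂ`: the inner variable is `x`,
the outer variable is `y`. -/

/-- The partial derivative `∂F/∂x`, which differentiates the coefficients of `F`. (The partial
derivative `∂F/∂y` is `Polynomial.derivative F`.) -/
def partialX (F : ℂ[X][Y]) : ℂ[X][Y] :=
  PolynomialModule.equivPolynomialSelf ((derivative' (R := ℂ)).mapCoeffs F)

/-- The action on polynomials of the vector field `P ∂/∂x + Q ∂/∂y`. -/
def vectorField (P Q F : ℂ[X][Y]) : ℂ[X][Y] :=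
  P * partialX F + Q * derivative F

/-- `F` is an invariant algebraic curve (a Darboux polynomial) of the system
`x_t = P(x,y)`, `y_t = Q(x,y)`: it is not constant and divides its derivative along
the vector field; the quotient is the cofactor. -/
def IsInvariantCurve (P Q F : ℂ[X][Y]) : Prop :=
  (∀ c : ℂ, F ≠ C (C c)) ∧ ∃ cofactor : ℂ[X][Y], vectorField P Q F = cofactor * F

/-- The system `x_t = P(x,y)`, `y_t = Q(x,y)` has a rational first integral: a non-constant rational
function `A / B` whose derivative `(B · 𝒳A - A · 𝒳B) / B²` along the vector field `𝒳` is zero. -/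
def HasRationalFirstIntegral (P Q : ℂ[X][Y]) : Prop :=
  ∃ A B : ℂ[X][Y], B ≠ 0 ∧ (∀ c : ℂ, A ≠ C (C c) * B) ∧
    B * vectorField P Q A - A * vectorField P Q B = 0

/-- The right-hand side `-f(x) y - g(x)` of the second equation of the Liénard system
`x_t = y`, `y_t = -f(x) y - g(x)`. -/
def rhs (f g : ℂ[X]) : ℂ[X][Y] := -(C f * Y) - C g

/-- `F` is an irreducible invariant algebraic curve of the Liénard system
`x_t = y`, `y_t = -f(x) y - g(x)`. -/
def IsIrreducibleCurve (f g : ℂ[X]) (F : ℂ[X][Y]) : Prop :=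
  Irreducible F ∧ IsInvariantCurve Y (rhs f g) F

/-- The set of irreducible invariant algebraic curves of the Liénard system, where polynomials that
differ by a nonzero constant factor are identified. -/
def irreducibleCurves (f g : ℂ[X]) : Set (Associates ℂ[X][Y]) :=
  {c | ∃ F, IsIrreducibleCurve f g F ∧ Associates.mk F = c}

/-! Laurent series near `x = ∞` are Laurent series in the local parameter `t = x⁻¹`: the coefficient
of `x ^ (-k)` in `y` is `y.coeff k`. -/

/-- The expansion at `x = ∞` of a polynomial in `x`, with `x = t⁻¹`. -/
def atInfinity : ℂ[X] →+* LaurentSeries ℂ :=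
  (aeval (HahnSeries.single (-1 : ℤ) (1 : ℂ) : LaurentSeries ℂ)).toRingHom

/-- The derivative `d/dx = -t² d/dt` of a Laurent series near `x = ∞`. -/
def derivX (y : LaurentSeries ℂ) : LaurentSeries ℂ :=
  -(HahnSeries.single (2 : ℤ) (1 : ℂ) * LaurentSeries.derivative ℂ y)

/-- `y` is a series of type (II): a Laurent series near `x = ∞` with leading term
`-(g₀ / f₀) x ^ (n - m)`, where `m = deg f`, `n = deg g` and `f₀`, `g₀` are the leading
coefficients, that solves the equation `y y_x + f(x) y + g(x) = 0`. -/
def IsTypeTwoSeries (f g : ℂ[X]) (y : LaurentSeries ℂ) : Prop :=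
  (∀ k : ℤ, k < (f.natDegree : ℤ) - g.natDegree → y.coeff k = 0) ∧
  y.coeff ((f.natDegree : ℤ) - g.natDegree) = -(g.leadingCoeff / f.leadingCoeff) ∧
  y * derivX y + atInfinity f * y + atInfinity g = 0

/-- The curve `F` captures the series `y`, that is `F(x, y(x)) = 0`. -/
def Captures (F : ℂ[X][Y]) (y : LaurentSeries ℂ) : Prop :=
  F.eval₂ atInfinity y = 0

/-- The exponent of the factor `y - y(x)` in the factorization of `F` over series near `x = ∞`. -/
def captureExponent (F : ℂ[X][Y]) (y : LaurentSeries ℂ) : ℕ :=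
  (F.map atInfinity).rootMultiplicity y

/-- The coefficients `q_l`, `0 ≤ l ≤ m = deg f`, in
`q(x) = q_0 x ^ (m + 1) + q_1 x ^ m + ⋯ + q_m x`: with `f = f_0 x ^ m + ⋯ + f_m`,
`q_0 = -f_0 / (m + 1)` and, for `1 ≤ l ≤ m`,
`q_l = (m + 1) / ((m + 1 - l) f_0) * (∑_{k=0}^{l-1} q_k f_{l-k}
  + ∑_{k=1}^{l-1} (m + 1 - k) q_k q_{l-k} + [coefficient of x ^ (2m + 1 - l) in g])`.
The second clause below gives `q_{l+1}`, and its second sum is re-indexed by `k ↦ k + 1`. -/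
def qCoeff (f g : ℂ[X]) : ℕ → ℂ
  | 0 => -(f.leadingCoeff / ((f.natDegree : ℂ) + 1))
  | l + 1 =>
    ((f.natDegree : ℂ) + 1) / (((f.natDegree : ℂ) - (l : ℂ)) * f.leadingCoeff) *
      ((∑ k : Fin (l + 1), qCoeff f g k.1 * f.coeff (f.natDegree - (l + 1 - k.1))) +
        (∑ k : Fin l,
          ((f.natDegree : ℂ) - (k.1 : ℂ)) * qCoeff f g (k.1 + 1) * qCoeff f g (l - k.1)) +
        g.coeff (2 * f.natDegree - l))
  decreasing_by all_goals omega

/-- The polynomial `q(x)`: the part with positive exponents of the series of type (I), which are the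
series near `x = ∞` with leading term `-(f_0 / (m + 1)) x ^ (m + 1)` that solve
`y y_x + f(x) y + g(x) = 0`. -/
def q (f g : ℂ[X]) : ℂ[X] :=
  ∑ l ∈ Finset.range (f.natDegree + 1), C (qCoeff f g l) * X ^ (f.natDegree + 1 - l)

/-- The polynomial `y - q(x) - z`. -/
def lineCurve (f g : ℂ[X]) (z : ℂ) : ℂ[X][Y] := Y - C (q f g) - C (C z)

end

end Lienard

/-! Let `F` be an irreducible invariant curve that does not capture the series `y` of type (II). The
cofactor of `F` is a polynomial `l(x)`, equal to `y` times the logarithmic derivative of `F(x, y)`,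
so `deg l < m`. The translation `y ↦ y + q(x)` removes the leading terms of `f` and of the equation;
comparing degrees in `x` then shows that the translated `F` has constant coefficients, hence that
`F` is `y - q(x) - z` up to a constant, and two such curves would force `q' + f = 0` and `g = 0`.
Two irreducible curves that capture `y` are associated by Gauss's lemma, so there are at most two
irreducible curves. A rational first integral `A / B` would give infinitely many, since every
irreducible factor of `A - c B` is invariant. -/

namespace Lienard

section Darboux

variable {k R : Type*} [Field k] [CommRing R] [Algebra k R]

theorem dvd_derivation_of_irreducible_dvd [CharZero k] [IsDomain R] [UniqueFactorizationMonoid R]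
    (D : Derivation k R R) {F p : R} (hF : F ≠ 0) (h : F ∣ D F)
    (hp : Irreducible p) (hpF : p ∣ F) : p ∣ D p := by
  obtain ⟨G, hFG, hG⟩ :=
    (FiniteMultiplicity.of_prime_left hp.prime hF).exists_eq_pow_mul_and_not_dvd
  obtain ⟨n, hn⟩ : ∃ n, multiplicity p F = n + 1 := by
    refine Nat.exists_eq_succ_of_ne_zero fun h0 => hG ?_
    rwa [hFG, h0, pow_zero, one_mul] at hpF
  rw [hn] at hFG
  have hDF : D F = p ^ (n + 1) * D G + p ^ n * (G * ((n + 1 : ℕ) * D p)) := by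
    rw [hFG, D.leibniz, D.leibniz_pow, Nat.add_sub_cancel]
    simp only [smul_eq_mul, nsmul_eq_mul]
    ring
  have hdvd : p ^ (n + 1) ∣ p ^ n * (G * ((n + 1 : ℕ) * D p)) :=
    (dvd_add_right (dvd_mul_right _ _)).1 (hDF ▸ (Dvd.intro G hFG.symm).trans h)
  rw [pow_succ, mul_dvd_mul_iff_left (pow_ne_zero n hp.ne_zero)] at hdvd
  have hunit : IsUnit ((n + 1 : ℕ) : R) := by
    rw [← map_natCast (algebraMap k R)]
    exact (isUnit_iff_ne_zero.2 (Nat.cast_ne_zero.2 n.succ_ne_zero)).map _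
  exact hunit.dvd_mul_left.1 ((hp.prime.dvd_or_dvd hdvd).resolve_left hG)

theorem dvd_derivation_sub_smul [IsDomain R] [DecompositionMonoid R] (D : Derivation k R R)
    {A B : R} (hAB : IsRelPrime A B) (hB : B ≠ 0) (h : B * D A = A * D B) (c : k) :
    A - c • B ∣ D (A - c • B) := by
  obtain ⟨l, hl⟩ : B ∣ D B := hAB.symm.dvd_of_dvd_mul_left ⟨D A, h.symm⟩
  have hA : D A = A * l := mul_left_cancel₀ hB (by rw [h, hl]; ring)
  exact ⟨l, by rw [map_sub, D.map_smul, hA, hl, sub_mul, smul_mul_assoc]⟩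

theorem subsingleton_setOf_isUnit_sub_smul [IsDomain R]
    (hunit : ∀ r : R, IsUnit r → ∃ c : k, algebraMap k R c = r) {A B : R} (hB : B ≠ 0)
    (hAB : ∀ c : k, A ≠ c • B) : {c : k | IsUnit (A - c • B)}.Subsingleton := by
  intro c hc d hd
  obtain ⟨s, hs⟩ := hunit _ hc
  obtain ⟨t, ht⟩ := hunit _ hd
  by_contra hcd
  have hst : (s - t) • (1 : R) = (d - c) • B := by
    rw [← Algebra.algebraMap_eq_smul_one, map_sub, hs, ht, sub_smul]
    ring
  have hne : s - t ≠ 0 := fun h => by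
    rw [h, zero_smul] at hst
    exact smul_ne_zero (sub_ne_zero.2 (Ne.symm hcd)) hB hst.symm
  refine hAB (c + s * (s - t)⁻¹ * (d - c)) ?_
  rw [add_smul, mul_smul, ← hst, smul_smul, mul_assoc, inv_mul_cancel₀ hne, mul_one,
    ← Algebra.algebraMap_eq_smul_one, hs, add_sub_cancel]

theorem eq_of_isRelPrime_of_dvd_sub_smul {A B p : R} (hAB : IsRelPrime A B) (hp : ¬ IsUnit p)
    {c d : k} (hc : p ∣ A - c • B) (hd : p ∣ A - d • B) : c = d := by
  by_contra hcd
  have hB : p ∣ B := by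
    have h : p ∣ (d - c) • B := by
      rw [sub_smul, ← sub_sub_sub_cancel_left]
      exact dvd_sub hc hd
    simpa [smul_smul, inv_mul_cancel₀ (sub_ne_zero.2 (Ne.symm hcd))] using
      h.trans (dvd_smul_of_dvd (d - c)⁻¹ dvd_rfl)
  exact hp (hAB ((dvd_sub_left (dvd_smul_of_dvd c hB)).1 hc) hB)

theorem infinite_setOf_irreducible_dvd_derivation [CharZero k] [IsDomain R]
    [UniqueFactorizationMonoid R]
    (hunit : ∀ r : R, IsUnit r → ∃ c : k, algebraMap k R c = r) (D : Derivation k R R)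
    {A B : R} (hB : B ≠ 0) (hAB : ∀ c : k, A ≠ c • B) (h : B * D A = A * D B) :
    {a : Associates R | ∃ p, Irreducible p ∧ p ∣ D p ∧ Associates.mk p = a}.Infinite := by
  obtain ⟨A, B, G, hrel, rfl, rfl⟩ := UniqueFactorizationMonoid.exists_reduced_factors' A B hB
  have hB' : B ≠ 0 := right_ne_zero_of_mul hB
  have hAB' : ∀ c : k, A ≠ c • B := fun c hc => hAB c (by rw [hc, mul_smul_comm])
  have h' : B * D A = A * D B := by
    simp only [D.leibniz, smul_eq_mul] at h
    refine mul_left_cancel₀ (pow_ne_zero 2 (left_ne_zero_of_mul hB)) ?_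
    linear_combination h
  set S : Set k := {c | IsUnit (A - c • B)}ᶜ
  have hSinf : S.Infinite :=
    (subsingleton_setOf_isUnit_sub_smul hunit hB' hAB').finite.infinite_compl
  have hfactor : ∀ c : S, ∃ p, Irreducible p ∧ p ∣ D p ∧ p ∣ A - c.1 • B := by
    rintro ⟨c, hc⟩
    have hne : A - c • B ≠ 0 := sub_ne_zero.2 (hAB' c)
    obtain ⟨p, hp, hpc⟩ := WfDvdMonoid.exists_irreducible_factor hc hne
    exact ⟨p, hp, dvd_derivation_of_irreducible_dvd D hne
      (dvd_derivation_sub_smul D hrel hB' h' c) hp hpc, hpc⟩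
  choose p hp hpD hpc using hfactor
  have hinj : Function.Injective fun c : S => Associates.mk (p c) := fun c d hcd =>
    Subtype.ext <| eq_of_isRelPrime_of_dvd_sub_smul hrel (hp c).not_isUnit (hpc c)
      ((Associates.mk_eq_mk_iff_associated.1 hcd).dvd.trans (hpc d))
  have : Infinite S := hSinf.to_subtype
  refine (Set.infinite_range_of_injective hinj).mono ?_
  rintro _ ⟨c, rfl⟩
  exact ⟨p c, hp c, hpD c, rfl⟩

end Darboux

section VectorField

/-- The derivation `∂/∂x` of `ℂ[X][Y]`; its underlying function is `partialX`. -/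
noncomputable def partialXDerivation : Derivation ℂ ℂ[X][Y] ℂ[X][Y] :=
  PolynomialModule.equivPolynomialSelf.compDer (derivative' (R := ℂ)).mapCoeffs

/-- The derivation `P ∂/∂x + Q ∂/∂y` of `ℂ[X][Y]`; its underlying function is `vectorField P Q`. -/
noncomputable def vectorFieldDerivation (P Q : ℂ[X][Y]) : Derivation ℂ ℂ[X][Y] ℂ[X][Y] :=
  P • partialXDerivation + Q • (derivative' (R := ℂ[X])).restrictScalars ℂ

theorem partialXDerivation_apply (F : ℂ[X][Y]) : partialXDerivation F = partialX F := rfl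

theorem vectorFieldDerivation_apply (P Q F : ℂ[X][Y]) :
    vectorFieldDerivation P Q F = vectorField P Q F := rfl

@[simp]
theorem coeff_partialX (F : ℂ[X][Y]) (i : ℕ) : (partialX F).coeff i = derivative (F.coeff i) := rfl

theorem partialX_C (p : ℂ[X]) : partialX (C p) = C (derivative p) := by
  ext1 i
  simp only [coeff_partialX, coeff_C, apply_ite derivative, map_zero]

theorem partialX_Y : partialX Y = 0 := by
  ext1 i
  simp only [coeff_partialX, coeff_X, apply_ite derivative, derivative_one, map_zero, ite_self,
    coeff_zero]

theorem map_eval₂_of_leibniz {S : Type*} [CommRing S] {D : S →+ S}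
    (hD : ∀ a b, D (a * b) = a * D b + b * D a) {φ : ℂ[X] →+* S}
    (hφ : ∀ a, D (φ a) = φ (derivative a)) (F : ℂ[X][Y]) (y : S) :
    D (F.eval₂ φ y) = (partialX F).eval₂ φ y + (derivative F).eval₂ φ y * D y := by
  induction F using Polynomial.induction_on with
  | C a => simp only [eval₂_C, hφ, partialX_C, derivative_C, eval₂_zero, zero_mul, add_zero]
  | add F G hF hG =>
    simp only [← partialXDerivation_apply, eval₂_add, map_add] at hF hG ⊢
    rw [hF, hG]
    ring
  | monomial n a ih =>
    rw [pow_succ, ← mul_assoc, eval₂_mul, hD, ih, ← partialXDerivation_apply (_ * Y),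
      Derivation.leibniz, derivative_mul (g := Y), partialXDerivation_apply,
      partialXDerivation_apply, partialX_Y, derivative_X, eval₂_X]
    simp only [smul_eq_mul, mul_zero, zero_add, mul_one, eval₂_add, eval₂_mul, eval₂_X]
    ring

theorem isUnit_iff_exists_C_C {F : ℂ[X][Y]} : IsUnit F ↔ ∃ c : ℂ, c ≠ 0 ∧ C (C c) = F := by
  simp only [Polynomial.isUnit_iff, isUnit_iff_ne_zero]
  constructor
  · rintro ⟨_, ⟨c, hc, rfl⟩, rfl⟩
    exact ⟨c, hc, rfl⟩
  · rintro ⟨c, hc, rfl⟩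
    exact ⟨_, ⟨c, hc, rfl⟩, rfl⟩

theorem ne_C_C_of_irreducible {F : ℂ[X][Y]} (hF : Irreducible F) (c : ℂ) : F ≠ C (C c) := by
  rintro rfl
  exact hF.not_isUnit (isUnit_iff_exists_C_C.2 ⟨c, fun hc => hF.ne_zero (by simp [hc]), rfl⟩)

theorem isIrreducibleCurve_iff {f g : ℂ[X]} {F : ℂ[X][Y]} :
    IsIrreducibleCurve f g F ↔ Irreducible F ∧ F ∣ vectorField Y (rhs f g) F := by
  simp only [IsIrreducibleCurve, IsInvariantCurve, dvd_iff_exists_eq_mul_left]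
  exact and_congr_right fun hF => and_iff_right (ne_C_C_of_irreducible hF)

theorem HasRationalFirstIntegral.infinite_irreducibleCurves {f g : ℂ[X]}
    (h : HasRationalFirstIntegral Y (rhs f g)) : (irreducibleCurves f g).Infinite := by
  obtain ⟨A, B, hB, hAB, h⟩ := h
  have hunit : ∀ F : ℂ[X][Y], IsUnit F → ∃ c : ℂ, algebraMap ℂ ℂ[X][Y] c = F := fun F hF =>
    let ⟨c, _, hc⟩ := isUnit_iff_exists_C_C.1 hF
    ⟨c, hc⟩
  refine (infinite_setOf_irreducible_dvd_derivation hunit (vectorFieldDerivation Y (rhs f g)) hB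
    (fun c hc => hAB c (hc.trans (Algebra.smul_def c B))) (sub_eq_zero.1 h)).mono ?_
  rintro _ ⟨F, hF, hdvd, rfl⟩
  exact ⟨F, isIrreducibleCurve_iff.2 ⟨hF, hdvd⟩, rfl⟩

end VectorField

section Cofactor

variable {f g : ℂ[X]} {F : ℂ[X][Y]}

theorem coeff_vectorField_rhs (p f g : ℂ[X]) (F : ℂ[X][Y]) (j : ℕ) :
    (vectorField (Y + C p) (rhs f g) F).coeff j =
      (Y * partialX F).coeff j + p * derivative (F.coeff j) - j * (f * F.coeff j) -
        (j + 1) * (g * F.coeff (j + 1)) := by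
  have h : vectorField (Y + C p) (rhs f g) F =
      Y * partialX F + C p * partialX F - C f * (Y * derivative F) - C g * derivative F := by
    rw [vectorField, rhs]
    ring
  have hY : (Y * derivative F).coeff j = j * F.coeff j := by
    cases j <;> simp [coeff_derivative, mul_comm]
  simp only [h, coeff_add, coeff_sub, coeff_C_mul, hY, coeff_partialX, coeff_derivative]
  ring

theorem natDegree_le_one_of_vectorField_eq_mul {l : ℂ[X][Y]} (hF : F ≠ 0)
    (h : vectorField Y (rhs f g) F = l * F) :
    l.natDegree ≤ 1 ∧ derivative F.leadingCoeff = l.coeff 1 * F.leadingCoeff := by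
  have hcoeff (j : ℕ) (hj : F.natDegree ≤ j) :
      (l * F).coeff (j + 1) = derivative (F.coeff j) := by
    have h0 := coeff_vectorField_rhs 0 f g F (j + 1)
    rw [map_zero, add_zero, h, coeff_X_mul,
      coeff_eq_zero_of_natDegree_lt (show F.natDegree < j + 1 by lia),
      coeff_eq_zero_of_natDegree_lt (show F.natDegree < j + 1 + 1 by lia)] at h0
    simpa only [coeff_partialX, map_zero, mul_zero, add_zero, sub_zero] using h0
  have hdeg : (l * F).natDegree ≤ 1 + F.natDegree := by
    refine natDegree_le_iff_coeff_eq_zero.2 fun j hj => ?_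
    obtain ⟨j, rfl⟩ := Nat.exists_eq_succ_of_ne_zero (show j ≠ 0 by lia)
    rw [Nat.succ_eq_add_one, hcoeff j (by lia), coeff_eq_zero_of_natDegree_lt (by lia), map_zero]
  have hl : l.natDegree ≤ 1 := by
    rcases eq_or_ne l 0 with rfl | hl0
    · simp
    · rwa [natDegree_mul hl0 hF, Nat.add_le_add_iff_right] at hdeg
  refine ⟨hl, ?_⟩
  rw [leadingCoeff, ← hcoeff _ le_rfl, add_comm, coeff_mul_add_eq_of_natDegree_le hl le_rfl]

theorem derivative_leadingCoeff_eq_zero (hdvd : F ∣ vectorField Y (rhs f g) F) :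
    derivative F.leadingCoeff = 0 := by
  rcases eq_or_ne F 0 with rfl | hF
  · simp
  obtain ⟨l, hl⟩ := dvd_iff_exists_eq_mul_left.1 hdvd
  exact dvd_derivative_iff.1 ⟨l.coeff 1, by
    rw [(natDegree_le_one_of_vectorField_eq_mul hF hl).2, mul_comm]⟩

theorem exists_vectorField_eq_C_mul (hdvd : F ∣ vectorField Y (rhs f g) F) :
    ∃ l : ℂ[X], vectorField Y (rhs f g) F = C l * F := by
  rcases eq_or_ne F 0 with rfl | hF
  · exact ⟨0, by simp [← vectorFieldDerivation_apply]⟩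
  obtain ⟨l, hl⟩ := dvd_iff_exists_eq_mul_left.1 hdvd
  obtain ⟨hdeg, hcoeff⟩ := natDegree_le_one_of_vectorField_eq_mul hF hl
  rw [derivative_leadingCoeff_eq_zero hdvd, eq_comm,
    mul_eq_zero_iff_right (leadingCoeff_ne_zero.2 hF)] at hcoeff
  have h0 : l.natDegree = 0 := by
    by_contra h0
    obtain rfl | h1 : l = 0 ∨ l.natDegree = 1 := by lia
    · simp at h0
    · rw [← h1, coeff_natDegree, leadingCoeff_eq_zero] at hcoeff
      simp [hcoeff] at h0
  exact ⟨l.coeff 0, by rw [hl, ← eq_C_of_natDegree_eq_zero h0]⟩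

theorem IsIrreducibleCurve.natDegree_ne_zero (hF : IsIrreducibleCurve f g F) :
    F.natDegree ≠ 0 := by
  obtain ⟨hirr, hdvd⟩ := isIrreducibleCurve_iff.1 hF
  intro h0
  have hC := eq_C_of_derivative_eq_zero (derivative_leadingCoeff_eq_zero hdvd)
  refine ne_C_C_of_irreducible hirr (F.leadingCoeff.coeff 0) ?_
  rw [← hC, leadingCoeff, h0, ← eq_C_of_natDegree_eq_zero h0]

end Cofactor

section Translation

variable {m : ℕ} {f g p s r l : ℂ[X]}

/-- The left-hand side of `y y_x + f(x) y + g(x) = 0` at a polynomial `y = p(x)`. -/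
noncomputable def residual (f g p : ℂ[X]) : ℂ[X] := p * (derivative p + f) + g

theorem taylor_vectorField (p f g : ℂ[X]) (F : ℂ[X][Y]) :
    taylor p (vectorField Y (rhs f g) F) =
      vectorField (Y + C p) (rhs (derivative p + f) (residual f g p)) (taylor p F) := by
  have hx : partialX (taylor p F) =
      taylor p (partialX F) + taylor p (derivative F) * C (derivative p) := by
    simp only [taylor_apply, comp]
    refine (map_eval₂_of_leibniz (D := (partialXDerivation : ℂ[X][Y] →+ ℂ[X][Y]))
      partialXDerivation.leibniz partialX_C F (Y + C p)).trans ?_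
    simp only [AddMonoidHom.coe_coe, map_add, partialXDerivation_apply, partialX_Y, partialX_C,
      zero_add]
  have hy : derivative (taylor p F) = taylor p (derivative F) := by
    simp [taylor_apply, derivative_comp]
  simp only [vectorField, hx, hy, rhs, residual, map_add, map_sub, map_neg, taylor_mul,
    taylor_X, taylor_C, map_mul]
  ring

theorem coeff_mul_eq_zero_of_degree_lt {R : Type*} [Semiring R] {a b : R[X]} {d : ℕ}
    (ha : a.degree < m) (hb : b.natDegree ≤ d) : (a * b).coeff (m + d) = 0 := by
  rw [coeff_mul_add_eq_of_natDegree_le (natDegree_le_of_degree_le ha.le) hb,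
    coeff_eq_zero_of_degree_lt ha, zero_mul]

-- Comparing the coefficients of `x ^ (m + d + 1)`: `β` is the coefficient of `x ^ (d + 1)` in `B`,
-- a polynomial in `y`, and the identity says `(d + 1) p_{m+1} β = r_m β'`.
theorem natCast_mul_coeff_coeff_eq (hp : p.natDegree ≤ m + 1) (hs : s.degree < m)
    (hr : r.natDegree ≤ m) (hl : l.degree < m) {B : ℂ[X][Y]}
    (hB : vectorField (Y + C p) (rhs s r) B = C l * B) {d : ℕ}
    (hd : ∀ j, (B.coeff j).natDegree ≤ d + 1) (j : ℕ) :
    (d + 1) * p.coeff (m + 1) * (B.coeff j).coeff (d + 1) =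
      (j + 1) * r.coeff m * (B.coeff (j + 1)).coeff (d + 1) := by
  have hd' (j : ℕ) : (derivative (B.coeff j)).natDegree ≤ d :=
    (natDegree_derivative_le _).trans (Nat.sub_le_of_le_add (hd j))
  have hY : ((Y * partialX B).coeff j).coeff (m + (d + 1)) = 0 := by
    cases j with
    | zero => simp
    | succ j =>
      rw [coeff_X_mul, coeff_partialX]
      exact coeff_eq_zero_of_natDegree_lt ((hd' j).trans_lt (by lia))
  have hpB : (p * derivative (B.coeff j)).coeff (m + (d + 1)) =
      p.coeff (m + 1) * ((B.coeff j).coeff (d + 1) * (d + 1)) := by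
    rw [← add_assoc, add_right_comm, coeff_mul_add_eq_of_natDegree_le hp (hd' j),
      coeff_derivative]
  have h := congrArg (fun b : ℂ[X] => b.coeff (m + (d + 1)))
    (coeff_vectorField_rhs p s r B j)
  have hcast : (j : ℂ[X]) + 1 = ((j + 1 : ℕ) : ℂ[X]) := by push_cast; rfl
  simp only [hB, hcast, coeff_C_mul, coeff_add, coeff_sub, coeff_natCast_mul, hY, hpB,
    coeff_mul_eq_zero_of_degree_lt hl (hd j), coeff_mul_eq_zero_of_degree_lt hs (hd j),
    coeff_mul_add_eq_of_natDegree_le hr (hd (j + 1))] at h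
  push_cast at h
  linear_combination -h

theorem natDegree_coeff_le_of_vectorField_eq (hp : p.natDegree = m + 1) (hs : s.degree < m)
    (hr : r.natDegree ≤ m) (hl : l.degree < m) {B : ℂ[X][Y]}
    (hB : vectorField (Y + C p) (rhs s r) B = C l * B) {d : ℕ}
    (hd : ∀ j, (B.coeff j).natDegree ≤ d + 1) (j : ℕ) : (B.coeff j).natDegree ≤ d := by
  have hp0 : (d + 1) * p.coeff (m + 1) ≠ 0 := by
    refine mul_ne_zero (by exact_mod_cast d.succ_ne_zero) ?_
    rw [← hp, coeff_natDegree, leadingCoeff_ne_zero]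
    rintro rfl
    simp at hp
  have htop : ∀ i j, B.natDegree < i + j → (B.coeff j).coeff (d + 1) = 0 := by
    intro i
    induction i with
    | zero =>
      intro j hj
      rw [coeff_eq_zero_of_natDegree_lt (p := B) (by lia), coeff_zero]
    | succ i ih =>
      intro j hj
      have h := natCast_mul_coeff_coeff_eq hp.le hs hr hl hB hd j
      rw [ih (j + 1) (by lia), mul_zero] at h
      exact (mul_eq_zero.1 h).resolve_left hp0
  refine natDegree_le_iff_coeff_eq_zero.2 fun k hk => ?_
  obtain rfl | hk' := (Nat.succ_le_of_lt hk).eq_or_lt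
  · exact htop (B.natDegree + 1) j (by lia)
  · exact coeff_eq_zero_of_natDegree_lt ((hd j).trans_lt hk')

theorem natDegree_coeff_eq_zero_of_vectorField_eq (hp : p.natDegree = m + 1) (hs : s.degree < m)
    (hr : r.natDegree ≤ m) (hl : l.degree < m) {B : ℂ[X][Y]}
    (hB : vectorField (Y + C p) (rhs s r) B = C l * B) (j : ℕ) : (B.coeff j).natDegree = 0 := by
  suffices h : ∀ d, (∀ j, (B.coeff j).natDegree ≤ d) → ∀ j, (B.coeff j).natDegree = 0 by
    refine h (B.support.sup fun j => (B.coeff j).natDegree) (fun j => ?_) j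
    by_cases hj : j ∈ B.support
    · exact Finset.le_sup (f := fun j => (B.coeff j).natDegree) hj
    · simp [notMem_support_iff.1 hj]
  intro d
  induction d with
  | zero => exact fun h j => Nat.le_zero.1 (h j)
  | succ d ih => exact fun hd => ih (natDegree_coeff_le_of_vectorField_eq hp hs hr hl hB hd)

theorem Y_sub_C_dvd_vectorField_iff :
    Y - C p ∣ vectorField Y (rhs f g) (Y - C p) ↔ residual f g p = 0 := by
  have h : (vectorField Y (rhs f g) (Y - C p)).eval p = -residual f g p := by
    simp only [vectorField, ← partialXDerivation_apply, map_sub]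
    simp only [partialXDerivation_apply, partialX_Y, partialX_C, rhs, residual, derivative_X,
      derivative_C, eval_mul, eval_add, eval_sub, eval_neg, eval_X, eval_C, eval_zero, eval_one]
    ring
  rw [dvd_iff_isRoot, IsRoot, h, neg_eq_zero]

theorem exists_associated_Y_sub_C (hp : p.natDegree = m + 1) (hs : (derivative p + f).degree < m)
    (hr : (residual f g p).natDegree ≤ m) (hl : l.degree < m) {F : ℂ[X][Y]}
    (hF : IsIrreducibleCurve f g F) (hlF : vectorField Y (rhs f g) F = C l * F) :
    ∃ z : ℂ, Associated (Y - C (p + C z)) F := by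
  obtain ⟨B, hB⟩ : ∃ B : ℂ[X], B.map C = taylor p F := by
    have hdeg := natDegree_coeff_eq_zero_of_vectorField_eq (B := taylor p F) hp hs hr hl
      (by rw [← taylor_vectorField, hlF, taylor_mul, taylor_C])
    exact mem_lifts _ |>.1 <| (lifts_iff_coeff_lifts _).2 fun j =>
      ⟨_, (eq_C_of_natDegree_eq_zero (hdeg j)).symm⟩
  obtain ⟨z, hz⟩ : ∃ z, B.IsRoot z := by
    refine IsAlgClosed.exists_root B fun h0 => hF.natDegree_ne_zero ?_
    rw [← natDegree_taylor F p, ← hB, natDegree_map_eq_of_injective C_injective,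
      natDegree_eq_of_degree_eq_some h0]
    rfl
  refine ⟨z, (irreducible_X_sub_C _).associated_of_dvd hF.1 ?_⟩
  have hroot : (taylor p F).IsRoot (C z) := hB ▸ hz.map
  rwa [dvd_iff_isRoot, IsRoot, add_comm, ← taylor_eval]

end Translation

section PolynomialPart

variable {f g : ℂ[X]}

theorem coeff_mul_add_sub {R : Type*} [Semiring R] {A B : R[X]} {a b l : ℕ}
    (hA : A.natDegree ≤ a) (hB : B.natDegree ≤ b) (hla : l ≤ a) (hlb : l ≤ b) :
    (A * B).coeff (a + b - l) =
      ∑ k ∈ Finset.range (l + 1), A.coeff (a - k) * B.coeff (b - (l - k)) := by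
  rw [← revAt_le (show l ≤ a + b by lia), ← coeff_reflect, reflect_mul _ _ hA hB, coeff_mul,
    Finset.Nat.sum_antidiagonal_eq_sum_range_succ
      (fun i j => (reflect a A).coeff i * (reflect b B).coeff j)]
  refine Finset.sum_congr rfl fun k hk => ?_
  rw [coeff_reflect, coeff_reflect, revAt_le (by grind), revAt_le (by grind)]

theorem coeff_q {l : ℕ} (hl : l ≤ f.natDegree) :
    (q f g).coeff (f.natDegree + 1 - l) = qCoeff f g l := by
  rw [q, finsetSum_coeff, Finset.sum_eq_single_of_mem l (Finset.mem_range.2 (by lia))]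
  · simp
  · intro k hk hkl
    rw [coeff_C_mul_X_pow, if_neg (by grind)]

theorem qCoeff_zero : qCoeff f g 0 = -(f.leadingCoeff / ((f.natDegree : ℂ) + 1)) := by
  rw [qCoeff]

theorem mul_qCoeff_succ {l : ℕ} (hl : l < f.natDegree) :
    ((f.natDegree : ℂ) - l) * f.leadingCoeff * qCoeff f g (l + 1) =
      ((f.natDegree : ℂ) + 1) *
      ((∑ k ∈ Finset.range (l + 1), qCoeff f g k * f.coeff (f.natDegree - (l + 1 - k))) +
        (∑ k ∈ Finset.range l,
          ((f.natDegree : ℂ) - k) * qCoeff f g (k + 1) * qCoeff f g (l - k)) +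
        g.coeff (2 * f.natDegree - l)) := by
  have hf : f.leadingCoeff ≠ 0 := leadingCoeff_ne_zero.2 (by rintro rfl; simp at hl)
  have hl' : (f.natDegree : ℂ) - l ≠ 0 := sub_ne_zero.2 (by exact_mod_cast hl.ne')
  rw [qCoeff, Finset.sum_range, Finset.sum_range]
  field_simp

theorem natDegree_q_le : (q f g).natDegree ≤ f.natDegree + 1 :=
  natDegree_sum_le_of_forall_le _ _ fun _ _ =>
    (natDegree_C_mul_X_pow_le _ _).trans (Nat.sub_le _ _)

theorem natDegree_q (hf : f ≠ 0) : (q f g).natDegree = f.natDegree + 1 := by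
  refine natDegree_q_le.antisymm (le_natDegree_of_ne_zero ?_)
  rw [← Nat.sub_zero (_ + 1), coeff_q f.natDegree.zero_le, qCoeff_zero]
  exact neg_ne_zero.2 (div_ne_zero (leadingCoeff_ne_zero.2 hf) (Nat.cast_add_one_ne_zero _))

theorem coeff_derivative_q_add {l : ℕ} (hl : l ≤ f.natDegree) :
    (derivative (q f g) + f).coeff (f.natDegree - l) =
      ((f.natDegree : ℂ) + 1 - l) * qCoeff f g l + f.coeff (f.natDegree - l) := by
  rw [coeff_add, coeff_derivative, ← Nat.sub_add_comm hl, coeff_q hl, Nat.cast_sub hl]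
  ring

theorem degree_derivative_q_add_lt :
    (derivative (q f g) + f).degree < f.natDegree := by
  have hle : (derivative (q f g) + f).natDegree ≤ f.natDegree :=
    natDegree_add_le_of_degree_le
      ((natDegree_derivative_le _).trans (Nat.sub_le_of_le_add natDegree_q_le)) le_rfl
  refine (degree_le_of_natDegree_le hle).lt_of_ne fun h => ?_
  have h0 := coeff_derivative_q_add (f := f) (g := g) f.natDegree.zero_le
  rw [Nat.sub_zero, coeff_natDegree, qCoeff_zero, Nat.cast_zero, sub_zero, mul_neg,
    mul_div_cancel₀ _ (Nat.cast_add_one_ne_zero _), neg_add_cancel] at h0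
  exact coeff_ne_zero_of_eq_degree h h0

theorem coeff_q_mul_derivative_q_add {l : ℕ} (hl : l ≤ f.natDegree) :
    (q f g * (derivative (q f g) + f)).coeff (f.natDegree + 1 + f.natDegree - l) =
      ∑ k ∈ Finset.range l, qCoeff f g k * (((f.natDegree : ℂ) + 1 - (l - k : ℕ)) *
        qCoeff f g (l - k) + f.coeff (f.natDegree - (l - k))) := by
  have hlt : (derivative (q f g) + f).degree < f.natDegree := degree_derivative_q_add_lt
  rw [coeff_mul_add_sub natDegree_q_le (natDegree_le_of_degree_le hlt.le) (by lia) hl,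
    Finset.sum_range_succ, Nat.sub_self, Nat.sub_zero, coeff_eq_zero_of_degree_lt hlt, mul_zero,
    add_zero]
  refine Finset.sum_congr rfl fun k hk => ?_
  have hk' : k < l := Finset.mem_range.1 hk
  rw [coeff_q (by lia), coeff_derivative_q_add (by lia)]

theorem coeff_residual_q_eq_zero {l : ℕ} (hl : l < f.natDegree) :
    (residual f g (q f g)).coeff (2 * f.natDegree - l) = 0 := by
  have hsum : ∑ k ∈ Finset.range l, qCoeff f g (k + 1) *
      (((f.natDegree : ℂ) + 1 - (l - k : ℕ)) * qCoeff f g (l - k)) =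
      ∑ k ∈ Finset.range l, ((f.natDegree : ℂ) - k) * qCoeff f g (k + 1) * qCoeff f g (l - k) := by
    rw [← Finset.sum_range_reflect]
    refine Finset.sum_congr rfl fun k hk => ?_
    have hk' : k < l := Finset.mem_range.1 hk
    rw [show l - 1 - k + 1 = l - k by lia, show l - (l - 1 - k) = k + 1 by lia]
    push_cast
    ring
  have hq := coeff_q_mul_derivative_q_add (g := g) (Nat.succ_le_of_lt hl)
  simp only [mul_add, Finset.sum_add_distrib] at hq
  rw [Finset.sum_range_succ', Nat.sub_zero] at hq
  simp only [Nat.succ_eq_add_one, Nat.add_sub_add_right, hsum, qCoeff_zero] at hq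
  rw [show f.natDegree + 1 + f.natDegree - (l + 1) = 2 * f.natDegree - l by lia] at hq
  rw [residual, coeff_add, mul_add, hq]
  refine mul_left_cancel₀ (Nat.cast_add_one_ne_zero (R := ℂ) f.natDegree) ?_
  have hrec := mul_qCoeff_succ (g := g) hl
  have hm : (f.natDegree : ℂ) + 1 ≠ 0 := Nat.cast_add_one_ne_zero _
  push_cast
  field_simp
  linear_combination -hrec

theorem natDegree_residual_q_le (hgf : g.natDegree < 2 * f.natDegree + 1) :
    (residual f g (q f g)).natDegree ≤ f.natDegree := by
  rw [natDegree_le_iff_coeff_eq_zero]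
  intro i hi
  rcases lt_or_ge (2 * f.natDegree) i with h | h
  · obtain ⟨d, rfl⟩ := Nat.exists_eq_add_of_lt hi
    rw [residual, coeff_add, coeff_eq_zero_of_natDegree_lt (hgf.trans_le h), add_zero, mul_comm,
      add_assoc, coeff_mul_eq_zero_of_degree_lt degree_derivative_q_add_lt
        (natDegree_q_le.trans (by lia))]
  · rw [← Nat.sub_sub_self h]
    exact coeff_residual_q_eq_zero (by lia)

end PolynomialPart

section LineCurve

variable {f g : ℂ[X]}

theorem lineCurve_eq (f g : ℂ[X]) (z : ℂ) : lineCurve f g z = Y - C (q f g + C z) := by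
  rw [lineCurve, C_add, sub_sub]

theorem exists_associated_lineCurve {F : ℂ[X][Y]} {l : ℂ[X]} (hf : f ≠ 0)
    (hgf : g.natDegree < 2 * f.natDegree + 1) (hF : IsIrreducibleCurve f g F)
    (hlF : vectorField Y (rhs f g) F = C l * F) (hl : l.degree < f.natDegree) :
    ∃ z, Associated (lineCurve f g z) F := by
  simp only [lineCurve_eq]
  exact exists_associated_Y_sub_C (natDegree_q hf) degree_derivative_q_add_lt
    (natDegree_residual_q_le hgf) hl hF hlF

theorem eq_of_lineCurve_dvd_vectorField (hg : g ≠ 0) {z w : ℂ}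
    (hz : lineCurve f g z ∣ vectorField Y (rhs f g) (lineCurve f g z))
    (hw : lineCurve f g w ∣ vectorField Y (rhs f g) (lineCurve f g w)) : z = w := by
  simp only [lineCurve_eq, Y_sub_C_dvd_vectorField_iff, residual, derivative_add, derivative_C,
    add_zero] at hz hw
  have hmul : C (z - w) * (derivative (q f g) + f) = 0 := by
    rw [C_sub]
    linear_combination hz - hw
  rcases mul_eq_zero.1 hmul with h | h
  · exact sub_eq_zero.1 (C_eq_zero.1 h)
  · exact absurd (by simpa [h] using hz) hg

end LineCurve

section AtInfinity

open HahnSeries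

variable {f g l p : ℂ[X]} {F : ℂ[X][Y]} {y : LaurentSeries ℂ}

theorem coeff_derivX (y : LaurentSeries ℂ) (k : ℤ) :
    (derivX y).coeff k = -(((k : ℂ) - 1) * y.coeff (k - 1)) := by
  rw [derivX, HahnSeries.coeff_neg, coeff_single_mul, one_mul, LaurentSeries.derivative_apply,
    LaurentSeries.hasseDeriv_coeff, Nat.cast_one, Ring.choose_one_right, zsmul_eq_mul,
    show k - 2 + 1 = k - 1 by ring]
  push_cast
  rfl

theorem coeff_single_neg_one_mul_derivX (y : LaurentSeries ℂ) (k : ℤ) :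
    (single (-1 : ℤ) (1 : ℂ) * derivX y).coeff k = -(k * y.coeff k) := by
  rw [coeff_single_mul, one_mul, coeff_derivX, sub_neg_eq_add, add_sub_cancel_right]
  push_cast
  ring

theorem support_single_neg_one_mul_derivX (y : LaurentSeries ℂ) :
    (single (-1 : ℤ) (1 : ℂ) * derivX y).support ⊆ y.support := by
  intro k hk h0
  rw [mem_support, coeff_single_neg_one_mul_derivX] at hk
  exact hk (by rw [h0, mul_zero, neg_zero])

theorem derivX_mul (y z : LaurentSeries ℂ) : derivX (y * z) = y * derivX z + z * derivX y := by
  have ht : single (-1 : ℤ) (1 : ℂ) ≠ 0 := single_ne_zero one_ne_zero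
  refine mul_left_cancel₀ ht ?_
  rw [mul_add, mul_left_comm _ y, mul_comm z, ← mul_assoc _ _ z]
  ext k
  rw [coeff_single_neg_one_mul_derivX, HahnSeries.coeff_add,
    coeff_mul_right' z.isPWO_support (support_single_neg_one_mul_derivX z),
    coeff_mul_left' y.isPWO_support (support_single_neg_one_mul_derivX y), HahnSeries.coeff_mul,
    ← Finset.sum_add_distrib, Finset.mul_sum, ← Finset.sum_neg_distrib]
  refine Finset.sum_congr rfl fun ij hij => ?_
  rw [coeff_single_neg_one_mul_derivX, coeff_single_neg_one_mul_derivX,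
    ← (Finset.mem_antidiagonal.1 hij).2.2]
  push_cast
  ring

theorem derivX_add (y z : LaurentSeries ℂ) : derivX (y + z) = derivX y + derivX z := by
  rw [derivX, map_add, mul_add, neg_add, derivX, derivX]

theorem coeff_atInfinity (p : ℂ[X]) (k : ℤ) :
    (atInfinity p).coeff k = if k ≤ 0 then p.coeff k.natAbs else 0 := by
  induction p using Polynomial.induction_on' with
  | add p r hp hr =>
    rw [map_add, HahnSeries.coeff_add, hp, hr, Polynomial.coeff_add, ← ite_add_zero]
  | monomial i c =>
    have h : atInfinity (monomial i c) = single (-(i : ℤ)) c := by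
      simp [atInfinity, aeval_monomial, single_pow, algebraMap_apply']
    rw [h, coeff_monomial, HahnSeries.coeff_single]
    grind

theorem atInfinity_injective : Function.Injective atInfinity := by
  intro p r h
  ext i
  have hi := congrArg (fun y : LaurentSeries ℂ => y.coeff (-(i : ℤ))) h
  simpa [coeff_atInfinity] using hi

theorem orderTop_atInfinity (hp : p ≠ 0) : (atInfinity p).orderTop = ↑(-(p.natDegree : ℤ)) := by
  refine (orderTop_le_of_coeff_ne_zero ?_).antisymm (le_orderTop_iff_forall.2 fun k hk => ?_)
  · simpa [coeff_atInfinity] using hp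
  · have hk' : k < -(p.natDegree : ℤ) := WithTop.coe_lt_coe.1 hk
    rw [coeff_atInfinity, if_pos (by lia), coeff_eq_zero_of_natDegree_lt (by lia)]

theorem leadingCoeff_atInfinity (p : ℂ[X]) : (atInfinity p).leadingCoeff = p.leadingCoeff := by
  rcases eq_or_ne p 0 with rfl | hp
  · simp
  have h0 : atInfinity p ≠ 0 := (map_ne_zero_iff _ atInfinity_injective).2 hp
  have ho : (atInfinity p).order = -(p.natDegree : ℤ) := WithTop.coe_inj.1 <| by
    rw [order_eq_orderTop_of_ne_zero h0, orderTop_atInfinity hp]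
  rw [HahnSeries.leadingCoeff_eq, ho, coeff_atInfinity, if_pos (by simp), Int.natAbs_neg,
    Int.natAbs_natCast, coeff_natDegree]

theorem derivX_atInfinity (p : ℂ[X]) : derivX (atInfinity p) = atInfinity (derivative p) := by
  ext k
  rw [coeff_derivX, coeff_atInfinity, coeff_atInfinity]
  rcases le_or_gt k 0 with hk | hk
  · obtain ⟨n, rfl⟩ : ∃ n : ℕ, k = -n := ⟨k.natAbs, by lia⟩
    rw [if_pos (by lia), if_pos hk, coeff_derivative, show (-(n : ℤ) - 1).natAbs = n + 1 by lia]
    simp only [Int.cast_neg, Int.cast_natCast, Int.natAbs_neg, Int.natAbs_natCast]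
    ring
  · rw [if_neg hk.not_ge]
    rcases eq_or_ne k 1 with rfl | hk1
    · simp
    · rw [if_neg (by lia), mul_zero, neg_zero]

theorem orderTop_add_one_le_orderTop_derivX (y : LaurentSeries ℂ) :
    y.orderTop + 1 ≤ (derivX y).orderTop := by
  refine le_orderTop_iff_forall.2 fun k hk => ?_
  have hk' : ((k - 1 : ℤ) : WithTop ℤ) < y.orderTop := by
    cases h : y.orderTop with
    | top => exact WithTop.coe_lt_top _
    | coe a =>
      rw [h] at hk
      have : k < a + 1 := by exact_mod_cast hk
      exact_mod_cast (by lia : k - 1 < a)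
  rw [coeff_derivX, coeff_eq_zero_of_lt_orderTop hk', mul_zero, neg_zero]

theorem eval₂_vectorField (hy : y * derivX y + atInfinity f * y + atInfinity g = 0)
    (F : ℂ[X][Y]) :
    (vectorField Y (rhs f g) F).eval₂ atInfinity y = y * derivX (F.eval₂ atInfinity y) := by
  have hchain : derivX (F.eval₂ atInfinity y) =
      (partialX F).eval₂ atInfinity y + (derivative F).eval₂ atInfinity y * derivX y :=
    map_eval₂_of_leibniz (D := AddMonoidHom.mk' derivX derivX_add) derivX_mul derivX_atInfinity F y
  rw [hchain]
  simp only [vectorField, rhs, eval₂_add, eval₂_mul, eval₂_sub, eval₂_neg, eval₂_X, eval₂_C]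
  linear_combination -(derivative F).eval₂ atInfinity y * hy

-- Dividing the equation `l F(x, y) = y (F(x, y))'` by `F(x, y) ≠ 0` gives `l` as `y` times a
-- logarithmic derivative, which decays at infinity.
theorem orderTop_add_one_le_of_not_captures
    (hy : y * derivX y + atInfinity f * y + atInfinity g = 0)
    (hl : vectorField Y (rhs f g) F = C l * F) (hF : ¬ Captures F y) :
    y.orderTop + 1 ≤ (atInfinity l).orderTop := by
  have h := eval₂_vectorField hy F
  rw [hl, eval₂_mul, eval₂_C] at h
  have ho := congrArg orderTop h
  rw [orderTop_mul, orderTop_mul] at ho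
  have hF' : (F.eval₂ atInfinity y).orderTop ≠ ⊤ := orderTop_ne_top.2 hF
  have hd := orderTop_add_one_le_orderTop_derivX (F.eval₂ atInfinity y)
  refine (WithTop.add_le_add_iff_right hF').1 ?_
  rw [ho, add_assoc, add_comm 1]
  gcongr

end AtInfinity

section FixedPoint

open HahnSeries

variable {R : Type*} [Ring R]

theorem exists_forall_le_orderTop_sub {a : ℤ} {u : ℕ → LaurentSeries R}
    (hu : ∀ n, a ≤ (u n).orderTop)
    (hcauchy : ∀ n : ℕ, ((a + n : ℤ) : WithTop ℤ) ≤ (u (n + 1) - u n).orderTop) :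
    ∃ y, ∀ n : ℕ, ((a + n : ℤ) : WithTop ℤ) ≤ (y - u n).orderTop := by
  have hle (n k : ℕ) (hnk : n ≤ k) : ((a + n : ℤ) : WithTop ℤ) ≤ (u k - u n).orderTop := by
    induction k, hnk using Nat.le_induction with
    | base => simp
    | succ k hnk ih =>
      rw [← sub_add_sub_cancel _ (u k)]
      have hk : ((a + n : ℤ) : WithTop ℤ) ≤ ((a + k : ℤ) : WithTop ℤ) := by
        exact_mod_cast (by lia : a + n ≤ a + k)
      exact (le_min (hk.trans (hcauchy k)) ih).trans min_orderTop_le_orderTop_add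
  let c (k : ℤ) : R := (u (k - a + 1).toNat).coeff k
  have hc : BddBelow (Function.support c) := ⟨a, fun k hk => le_of_not_gt fun hka =>
    hk (coeff_eq_zero_of_lt_orderTop ((WithTop.coe_lt_coe.2 hka).trans_le (hu _)))⟩
  refine ⟨ofSuppBddBelow c hc, fun n => le_orderTop_iff_forall.2 fun k hk => ?_⟩
  have hkn : k < a + n := WithTop.coe_lt_coe.1 hk
  have hcoeff : (u n - u (k - a + 1).toNat).coeff k = 0 := by
    refine coeff_eq_zero_of_lt_orderTop (lt_of_lt_of_le ?_ (hle _ n (by lia)))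
    exact WithTop.coe_lt_coe.2 (by lia)
  rw [HahnSeries.coeff_sub] at hcoeff ⊢
  rw [coeff_ofSuppBddBelow, ← neg_sub, hcoeff, neg_zero]

theorem existsUnique_fixedPoint {a : ℤ} {Φ : LaurentSeries R → LaurentSeries R}
    (hmaps : ∀ y : LaurentSeries R, a ≤ y.orderTop → a ≤ (Φ y).orderTop)
    (hcontr : ∀ (y z : LaurentSeries R) (b : ℤ), a ≤ y.orderTop → a ≤ z.orderTop →
      b ≤ (y - z).orderTop → ((b + 1 : ℤ) : WithTop ℤ) ≤ (Φ y - Φ z).orderTop) :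
    ∃! y : LaurentSeries R, a ≤ y.orderTop ∧ Φ y = y := by
  refine existsUnique_of_exists_of_unique ?_ ?_
  · let u (n : ℕ) : LaurentSeries R := Φ^[n] 0
    have hu_succ (n : ℕ) : u (n + 1) = Φ (u n) := Function.iterate_succ_apply' Φ n 0
    have hu (n : ℕ) : a ≤ (u n).orderTop := by
      induction n with
      | zero => simp [u]
      | succ n ih => exact hu_succ n ▸ hmaps _ ih
    obtain ⟨y, hy⟩ := exists_forall_le_orderTop_sub hu fun n => by
      induction n with
      | zero => simpa [u] using hu 1
      | succ n ih =>
        rw [hu_succ, hu_succ n, Nat.cast_succ, ← add_assoc]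
        exact hcontr _ _ _ (hu_succ n ▸ hu _) (hu _) (hu_succ n ▸ ih)
    have hya : a ≤ y.orderTop := by simpa [u] using hy 0
    refine ⟨y, hya, sub_eq_zero.1 (HahnSeries.ext (funext fun k => ?_))⟩
    obtain ⟨n, hn⟩ : ∃ n : ℕ, k < a + n + 1 := ⟨(k - a).toNat, by lia⟩
    have hsucc := hy (n + 1)
    rw [hu_succ, Nat.cast_succ, ← add_assoc, ← orderTop_neg, neg_sub] at hsucc
    have hle := (le_min (hcontr y (u n) _ hya (hu n) (hy n)) hsucc).trans
      min_orderTop_le_orderTop_add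
    rw [sub_add_sub_cancel] at hle
    exact coeff_eq_zero_of_lt_orderTop ((WithTop.coe_lt_coe.2 hn).trans_le hle)
  · rintro y z ⟨hya, hy⟩ ⟨hza, hz⟩
    by_contra hyz
    obtain ⟨b, hb⟩ := WithTop.ne_top_iff_exists.1 (orderTop_ne_top.2 (sub_ne_zero.2 hyz))
    have hlt := hcontr y z b hya hza hb.le
    rw [hy, hz, ← hb] at hlt
    exact (lt_add_one b).not_ge (WithTop.coe_le_coe.1 hlt)

end FixedPoint

section TypeTwoSeries

open HahnSeries

variable {f g : ℂ[X]} {y z : LaurentSeries ℂ}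

theorem le_orderTop_mul_derivX {a b : ℤ} (hy : a ≤ y.orderTop) (hz : b ≤ z.orderTop) :
    ((a + b + 1 : ℤ) : WithTop ℤ) ≤ (y * derivX z).orderTop := by
  have hz' : ((b + 1 : ℤ) : WithTop ℤ) ≤ (derivX z).orderTop :=
    (add_le_add_left hz 1).trans (orderTop_add_one_le_orderTop_derivX z)
  rw [add_assoc, WithTop.coe_add]
  exact (add_le_add hy hz').trans orderTop_add_le_mul

theorem orderTop_div_atInfinity (hf : f ≠ 0) (w : LaurentSeries ℂ) :
    (w / atInfinity f).orderTop = w.orderTop + ((f.natDegree : ℤ) : WithTop ℤ) := by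
  have hf' : atInfinity f ≠ 0 := (map_ne_zero_iff _ atInfinity_injective).2 hf
  conv_rhs => rw [← div_mul_cancel₀ w hf', orderTop_mul, orderTop_atInfinity hf, add_assoc,
    ← WithTop.coe_add, neg_add_cancel, WithTop.coe_zero, add_zero]

theorem orderTop_lt_orderTop_mul_derivX (hg : g ≠ 0) (hgf : g.natDegree < 2 * f.natDegree + 1)
    (hy : ((f.natDegree - g.natDegree : ℤ) : WithTop ℤ) ≤ y.orderTop) :
    (atInfinity g).orderTop < (y * derivX y).orderTop := by
  refine lt_of_lt_of_le ?_ (le_orderTop_mul_derivX hy hy)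
  rw [orderTop_atInfinity hg]
  exact WithTop.coe_lt_coe.2 (by lia)

/-- The map `y ↦ -(g + y y_x) / f` on Laurent series near `x = ∞`. Its fixed points solve
`y y_x + f(x) y + g(x) = 0`, and the series of type (II) is found among them by contraction. -/
noncomputable def solutionMap (f g : ℂ[X]) (y : LaurentSeries ℂ) : LaurentSeries ℂ :=
  -(atInfinity g + y * derivX y) / atInfinity f

theorem solutionMap_eq_self_iff (hf : f ≠ 0) :
    solutionMap f g y = y ↔ y * derivX y + atInfinity f * y + atInfinity g = 0 := by
  rw [solutionMap, div_eq_iff ((map_ne_zero_iff _ atInfinity_injective).2 hf)]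
  constructor <;> intro h <;> linear_combination -h

theorem orderTop_solutionMap (hf : f ≠ 0) (hg : g ≠ 0) (hgf : g.natDegree < 2 * f.natDegree + 1)
    (hy : ((f.natDegree - g.natDegree : ℤ) : WithTop ℤ) ≤ y.orderTop) :
    (solutionMap f g y).orderTop = ((f.natDegree - g.natDegree : ℤ) : WithTop ℤ) := by
  rw [solutionMap, orderTop_div_atInfinity hf, orderTop_neg,
    orderTop_add_eq_left (orderTop_lt_orderTop_mul_derivX hg hgf hy), orderTop_atInfinity hg,
    ← WithTop.coe_add, neg_add_eq_sub]

theorem coeff_eq_of_solutionMap_eq_self (hf : f ≠ 0) (hg : g ≠ 0)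
    (hgf : g.natDegree < 2 * f.natDegree + 1)
    (ha : ((f.natDegree - g.natDegree : ℤ) : WithTop ℤ) ≤ y.orderTop)
    (hy : solutionMap f g y = y) :
    y.coeff (f.natDegree - g.natDegree) = -(g.leadingCoeff / f.leadingCoeff) := by
  have horder : y.orderTop = ((f.natDegree - g.natDegree : ℤ) : WithTop ℤ) :=
    hy ▸ orderTop_solutionMap hf hg hgf ha
  have hy0 : y ≠ 0 := orderTop_ne_top.1 (horder ▸ WithTop.coe_ne_top)
  have hlead : y.leadingCoeff * f.leadingCoeff = -g.leadingCoeff := by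
    rw [solutionMap, div_eq_iff ((map_ne_zero_iff _ atInfinity_injective).2 hf)] at hy
    rw [← leadingCoeff_atInfinity, ← HahnSeries.leadingCoeff_mul, ← hy, HahnSeries.leadingCoeff_neg,
      HahnSeries.leadingCoeff_add_eq_left (orderTop_lt_orderTop_mul_derivX hg hgf ha),
      leadingCoeff_atInfinity]
  rw [← neg_div, eq_div_iff (Polynomial.leadingCoeff_ne_zero.2 hf), ← hlead,
    HahnSeries.leadingCoeff_of_ne_zero hy0]
  simp only [horder, WithTop.untop_coe]

theorem isTypeTwoSeries_iff (hf : f ≠ 0) (hg : g ≠ 0) (hgf : g.natDegree < 2 * f.natDegree + 1) :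
    IsTypeTwoSeries f g y ↔ ((f.natDegree - g.natDegree : ℤ) : WithTop ℤ) ≤ y.orderTop ∧
      solutionMap f g y = y := by
  rw [IsTypeTwoSeries, ← solutionMap_eq_self_iff hf]
  constructor
  · rintro ⟨ha, -, hy⟩
    exact ⟨le_orderTop_iff_forall.2 fun k hk => ha k (WithTop.coe_lt_coe.1 hk), hy⟩
  · rintro ⟨ha, hy⟩
    exact ⟨fun k hk => coeff_eq_zero_of_lt_orderTop ((WithTop.coe_lt_coe.2 hk).trans_le ha),
      coeff_eq_of_solutionMap_eq_self hf hg hgf ha hy, hy⟩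

theorem IsTypeTwoSeries.orderTop_eq (hf : f ≠ 0) (hg : g ≠ 0) (hy : IsTypeTwoSeries f g y) :
    y.orderTop = ((f.natDegree - g.natDegree : ℤ) : WithTop ℤ) := by
  obtain ⟨hlt, hcoeff, -⟩ := hy
  refine (orderTop_le_of_coeff_ne_zero ?_).antisymm
    (le_orderTop_iff_forall.2 fun k hk => hlt k (WithTop.coe_lt_coe.1 hk))
  rw [hcoeff, neg_ne_zero]
  exact div_ne_zero (Polynomial.leadingCoeff_ne_zero.2 hg) (Polynomial.leadingCoeff_ne_zero.2 hf)

theorem existsUnique_isTypeTwoSeries (hf : f ≠ 0) (hg : g ≠ 0)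
    (hgf : g.natDegree < 2 * f.natDegree + 1) : ∃! y, IsTypeTwoSeries f g y := by
  simp only [isTypeTwoSeries_iff hf hg hgf]
  refine existsUnique_fixedPoint (fun y hy => (orderTop_solutionMap hf hg hgf hy).ge)
    fun y z b hy hz hyz => ?_
  have hsub : solutionMap f g y - solutionMap f g z =
      -((y - z) * derivX y + z * derivX (y - z)) / atInfinity f := by
    have hadd : derivX y = derivX (y - z) + derivX z := by rw [← derivX_add, sub_add_cancel]
    rw [solutionMap, solutionMap, ← sub_div, hadd]
    ring
  have hle := (le_min (le_orderTop_mul_derivX hyz hy)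
    (add_comm _ b ▸ le_orderTop_mul_derivX hz hyz)).trans min_orderTop_le_orderTop_add
  rw [hsub, orderTop_div_atInfinity hf, orderTop_neg]
  refine le_trans ?_ (add_le_add_left hle _)
  rw [← WithTop.coe_add]
  exact WithTop.coe_le_coe.2 (by lia)

end TypeTwoSeries

section GaussLemma

variable {R L : Type*} [CommRing R] [IsDomain R] [Field L] {φ : R →+* L} {F G : R[X]}

theorem exists_comp_algebraMap_fractionRing_eq (hφ : Function.Injective φ) :
    ∃ ψ : FractionRing R →+* L, ψ.comp (algebraMap R (FractionRing R)) = φ :=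
  ⟨IsFractionRing.lift hφ, RingHom.ext fun p => IsFractionRing.lift_algebraMap hφ p⟩

variable [UniqueFactorizationMonoid R]

theorem associated_of_eval₂_eq_zero (hφ : Function.Injective φ) {y : L} (hF : Irreducible F)
    (hG : Irreducible G) (hF0 : F.natDegree ≠ 0) (hFy : F.eval₂ φ y = 0) (hGy : G.eval₂ φ y = 0) :
    Associated F G := by
  obtain ⟨ψ, hψ⟩ := exists_comp_algebraMap_fractionRing_eq hφ
  have hFp : F.IsPrimitive := hF.isPrimitive hF0
  have hFK := hFp.irreducible_iff_irreducible_map_fraction_map (K := FractionRing R) |>.1 hF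
  refine hF.associated_of_dvd hG (hFp.dvd_of_fraction_map_dvd_fraction_map (K := FractionRing R) ?_)
  by_contra hnd
  obtain ⟨A, B, hAB⟩ := hFK.coprime_iff_not_dvd.2 hnd
  have h01 := congrArg (eval₂ ψ y) hAB
  rw [eval₂_add, eval₂_mul, eval₂_mul, eval₂_map, eval₂_map, hψ, hFy, hGy, eval₂_one, mul_zero,
    mul_zero, add_zero] at h01
  exact zero_ne_one h01

theorem separable_map_of_irreducible [CharZero R] (hφ : Function.Injective φ)
    (hF : Irreducible F) (hF0 : F.natDegree ≠ 0) : (F.map φ).Separable := by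
  obtain ⟨ψ, hψ⟩ := exists_comp_algebraMap_fractionRing_eq hφ
  rw [← hψ, ← Polynomial.map_map]
  exact ((hF.isPrimitive hF0).irreducible_iff_irreducible_map_fraction_map
    (K := FractionRing R) |>.1 hF).separable.map

theorem captureExponent_eq_one {F : ℂ[X][Y]} {y : LaurentSeries ℂ} (hF : Irreducible F)
    (hF0 : F.natDegree ≠ 0) (hFy : Captures F y) : captureExponent F y = 1 := by
  refine le_antisymm (rootMultiplicity_le_one_of_separable
    (separable_map_of_irreducible atInfinity_injective hF hF0) y) ?_
  rw [captureExponent, Nat.one_le_iff_ne_zero, ← Nat.pos_iff_ne_zero, rootMultiplicity_pos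
    ((Polynomial.map_ne_zero_iff atInfinity_injective).2 hF.ne_zero), IsRoot, eval_map]
  exact hFy

end GaussLemma

section InvariantCurves

variable {f g : ℂ[X]} {F G : ℂ[X][Y]} {y : LaurentSeries ℂ}

theorem exists_associated_lineCurve_of_not_captures (hf : f ≠ 0) (hg : g ≠ 0)
    (hgf : g.natDegree < 2 * f.natDegree + 1) (hy : IsTypeTwoSeries f g y)
    (hF : IsIrreducibleCurve f g F) (hFy : ¬ Captures F y) :
    ∃ z, Associated (lineCurve f g z) F := by
  obtain ⟨l, hl⟩ := exists_vectorField_eq_C_mul (isIrreducibleCurve_iff.1 hF).2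
  refine exists_associated_lineCurve hf hgf hF hl ?_
  rcases eq_or_ne l 0 with rfl | hl0
  · exact degree_zero.trans_lt (WithBot.bot_lt_coe _)
  have hle := orderTop_add_one_le_of_not_captures hy.2.2 hl hFy
  rw [hy.orderTop_eq hf hg, orderTop_atInfinity hl0] at hle
  have hle' : (f.natDegree - g.natDegree + 1 : ℤ) ≤ -l.natDegree := by exact_mod_cast hle
  exact (natDegree_lt_iff_degree_lt hl0).1 (by lia)

theorem IsIrreducibleCurve.dvd_vectorField_of_associated (hF : IsIrreducibleCurve f g F)
    (h : Associated G F) : G ∣ vectorField Y (rhs f g) G :=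
  dvd_derivation_of_irreducible_dvd (vectorFieldDerivation Y (rhs f g)) hF.1.ne_zero
    (isIrreducibleCurve_iff.1 hF).2 (h.irreducible_iff.2 hF.1) h.dvd

theorem IsIrreducibleCurve.eq_of_associated_lineCurve (hg : g ≠ 0) (hF : IsIrreducibleCurve f g F)
    {z₀ z : ℂ} (hz₀ : Associated (lineCurve f g z₀) F)
    (hz : lineCurve f g z ∣ vectorField Y (rhs f g) (lineCurve f g z)) : z = z₀ :=
  eq_of_lineCurve_dvd_vectorField hg hz (hF.dvd_vectorField_of_associated hz₀)

theorem IsIrreducibleCurve.associated_of_captures_iff (hf : f ≠ 0) (hg : g ≠ 0)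
    (hgf : g.natDegree < 2 * f.natDegree + 1) (hy : IsTypeTwoSeries f g y)
    (hF : IsIrreducibleCurve f g F) (hG : IsIrreducibleCurve f g G)
    (h : Captures F y ↔ Captures G y) : Associated F G := by
  by_cases hFy : Captures F y
  · exact associated_of_eval₂_eq_zero atInfinity_injective hF.1 hG.1 hF.natDegree_ne_zero hFy
      (h.1 hFy)
  · obtain ⟨z, hz⟩ := exists_associated_lineCurve_of_not_captures hf hg hgf hy hF hFy
    obtain ⟨w, hw⟩ := exists_associated_lineCurve_of_not_captures hf hg hgf hy hG (h.not.1 hFy)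
    obtain rfl : w = z := hF.eq_of_associated_lineCurve hg hz
      (hG.dvd_vectorField_of_associated hw)
    exact hz.symm.trans hw

theorem encard_irreducibleCurves_le_two (hf : f ≠ 0) (hg : g ≠ 0)
    (hgf : g.natDegree < 2 * f.natDegree + 1) : (irreducibleCurves f g).encard ≤ 2 := by
  obtain ⟨y, hy, -⟩ := existsUnique_isTypeTwoSeries hf hg hgf
  choose F hF hFc using fun c : irreducibleCurves f g => c.2
  have hinj : Function.Injective fun c => Captures (F c) y := fun c d hcd => by
    rw [Subtype.ext_iff, ← hFc c, ← hFc d, Associates.mk_eq_mk_iff_associated]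
    exact (hF c).associated_of_captures_iff hf hg hgf hy (hF d) (iff_of_eq hcd)
  calc (irreducibleCurves f g).encard
      ≤ ENat.card Prop := ENat.card_le_card_of_injective hinj
    _ = 2 := by rw [ENat.card_eq_coe_fintype_card, Fintype.card_prop, Nat.cast_ofNat]

end InvariantCurves

theorem theorem7_general (f g : ℂ[X]) (hf : f ≠ 0) (hg : g ≠ 0)
    (hgf : g.natDegree < 2 * f.natDegree + 1) :
    (irreducibleCurves f g).encard ≤ 2 ∧
    (∃ y : LaurentSeries ℂ, IsTypeTwoSeries f g y ∧
      (∀ y' : LaurentSeries ℂ, IsTypeTwoSeries f g y' → y' = y) ∧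
      ∀ F₁ F₂ : ℂ[X][Y], IsIrreducibleCurve f g F₁ → IsIrreducibleCurve f g F₂ →
        ¬ Associated F₁ F₂ →
        ∃ G H : ℂ[X][Y], ((G = F₁ ∧ H = F₂) ∨ (G = F₂ ∧ H = F₁)) ∧
          Captures G y ∧ captureExponent G y = 1 ∧
          ∃ z₀ : ℂ, Associated H (lineCurve f g z₀) ∧
            ∀ z : ℂ, IsInvariantCurve Y (rhs f g) (lineCurve f g z) → z = z₀) ∧
    ¬ HasRationalFirstIntegral Y (rhs f g) := by
  have hcard := encard_irreducibleCurves_le_two hf hg hgf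
  obtain ⟨y, hy, huniq⟩ := existsUnique_isTypeTwoSeries hf hg hgf
  refine ⟨hcard, ⟨y, hy, huniq, fun F₁ F₂ hF₁ hF₂ hne => ?_⟩, fun h =>
    h.infinite_irreducibleCurves (Set.finite_of_encard_le_coe hcard)⟩
  wlog h₁ : Captures F₁ y generalizing F₁ F₂
  · have h₂ : Captures F₂ y := not_not.1 fun h₂ =>
      hne (hF₁.associated_of_captures_iff hf hg hgf hy hF₂ (iff_of_false h₁ h₂))
    obtain ⟨G, H, hGH, h⟩ := this F₂ F₁ hF₂ hF₁ (fun h => hne h.symm) h₂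
    exact ⟨G, H, hGH.symm, h⟩
  have h₂ : ¬ Captures F₂ y := fun h₂ =>
    hne (hF₁.associated_of_captures_iff hf hg hgf hy hF₂ (iff_of_true h₁ h₂))
  obtain ⟨z₀, hz₀⟩ := exists_associated_lineCurve_of_not_captures hf hg hgf hy hF₂ h₂
  exact ⟨F₁, F₂, .inl ⟨rfl, rfl⟩, h₁, captureExponent_eq_one hF₁.1 hF₁.natDegree_ne_zero h₁, z₀,
    hz₀.symm, fun z hz => hF₂.eq_of_associated_lineCurve hg hz₀ (dvd_iff_exists_eq_mul_left.2 hz.2)⟩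

end Lienard

theorem theorem7 (f g : Polynomial ℂ)
    (hfg : f.natDegree < g.natDegree) (hgf : g.natDegree < 2 * f.natDegree + 1) :
    (Lienard.irreducibleCurves f g).encard ≤ 2 ∧
    (∃ y : LaurentSeries ℂ, Lienard.IsTypeTwoSeries f g y ∧
      (∀ y' : LaurentSeries ℂ, Lienard.IsTypeTwoSeries f g y' → y' = y) ∧
      ∀ F₁ F₂ : Polynomial (Polynomial ℂ),
        Lienard.IsIrreducibleCurve f g F₁ → Lienard.IsIrreducibleCurve f g F₂ →
        ¬ Associated F₁ F₂ →
        ∃ G H : Polynomial (Polynomial ℂ), ((G = F₁ ∧ H = F₂) ∨ (G = F₂ ∧ H = F₁)) ∧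
          Lienard.Captures G y ∧ Lienard.captureExponent G y = 1 ∧
          ∃ z₀ : ℂ, Associated H (Lienard.lineCurve f g z₀) ∧
            ∀ z : ℂ, Lienard.IsInvariantCurve Polynomial.X (Lienard.rhs f g)
              (Lienard.lineCurve f g z) → z = z₀) ∧
    ¬ Lienard.HasRationalFirstIntegral Polynomial.X (Lienard.rhs f g) := by
  exact Lienard.theorem7_general f g (by rintro rfl; rw [natDegree_zero] at hfg hgf; lia)
    (ne_zero_of_natDegree_gt hfg) hgf
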